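/- Let $d\ge 1$, let $R\sim\mathrm{Unif}([0,1])$ and $Z\sim\mathcal N(0,I_d)$ be independent, and let $\rho$ be the law on $\mathbb R^d$ of $X=R\,Z/\|Z\|$. Let $\Sigma_1,\dots,\Sigma_N\in\mathbb R^{d\times d}$ be (symmetric) positive semi-definite matrices, $b_1,\dots,b_N\in\mathbb R^d$, and let $\mu^{(i)}=(\Sigma_i^{1/2}\,\mathrm{id}+b_i)_{\#}\rho$ for $1\le i\le N$, where $\Sigma_i^{1/2}$ is the positive semi-definite square root. Write $\langle A,B\rangle_F=\mathrm{Tr}(A^TB)$. Then $\rho$ is an absolutely continuous probability measure with compact support, and: (i) (Linearized optimal transport.) For every $i$ there is a $\rho$-a.e. unique measurable map $T_\rho^{\mu^{(i)}}:\mathbb R^d\to\mathbb R^d$ such that $(\mathrm{id},T_\rho^{\mu^{(i)}})_{\#}\rho$ minimizes $\int\|x-y\|^2\,\mathrm d\pi(x,y)$ among all couplings $\pi$ of $\rho$ and $\mu^{(i)}$. The embedding $\phi(\mu^{(i)})=T_\rho^{\mu^{(i)}}-\mathrm{id}$ belongs to $L^2(\rho,\mathbb R^d)$, and for all $1\le i,j\le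 N$ $$\langle\phi(\mu^{(i)}),\phi(\mu^{(j)})\rangle_{L^2(\rho)}=\langle b_i,b_j\rangle+\frac1{3d}\,\langle\Sigma_i^{1/2}-I_d,\Sigma_j^{1/2}-I_d\rangle_F .$$ (ii) (Kernel mean embedding.) The kernel $k(x,y)=x^Ty+(x^Ty)^2$ on $\mathbb R^d$ is positive semi-definite. If $\mathcal H$ is its reproducing kernel Hilbert space, then $x\mapsto k(x,\cdot)\in\mathcal H$ is Bochner integrable with respect to each $\mu^{(i)}$, and the embeddings $\phi(\mu^{(i)})=\int k(x,\cdot)\,\mathrm d\mu^{(i)}(x)\in\mathcal H$ satisfy, for all $1\le i,j\le N$, $$\langle\phi(\mu^{(i)}),\phi(\mu^{(j)})\rangle_{\mathcal H}=\langle b_i,b_j\rangle+\langle b_i,b_j\rangle^2+\frac1{3d}\langle\Sigma_j,b_ib_i^T\rangle_F+\frac1{3d}\langle\Sigma_i,b_jb_j^T\rangle_F+\frac1{9d^2}\langle\Sigma_i,\Sigma_j\rangle_F .$$ -/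

import Mathlib

open MeasureTheory ProbabilityTheory
open scoped ENNReal Matrix MatrixOrder

noncomputable section

/-- The Frobenius inner product `⟨A, B⟩_F = Tr(Aᵀ B)` of real matrices. -/
def frobInner {d : ℕ} (A B : Matrix (Fin d) (Fin d) ℝ) : ℝ := (Aᵀ * B).trace

/-- The affine map `x ↦ Σ^{1/2} x + b`, where `Σ^{1/2}` is the positive semidefinite square root
of the positive semidefinite matrix `Σ`. -/
def shiftScale {d : ℕ} (S : Matrix (Fin d) (Fin d) ℝ) (b : EuclideanSpace ℝ (Fin d)) :
    EuclideanSpace ℝ (Fin d) → EuclideanSpace ℝ (Fin d) :=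
  fun x => WithLp.toLp 2 (CFC.sqrt S *ᵥ x.ofLp) + b

/-- `π` is a transport plan between `ρ` and `μ`. -/
def IsTransportPlan {d : ℕ} (ρ μ : Measure (EuclideanSpace ℝ (Fin d)))
    (π : Measure (EuclideanSpace ℝ (Fin d) × EuclideanSpace ℝ (Fin d))) : Prop :=
  π.map Prod.fst = ρ ∧ π.map Prod.snd = μ

/-- The quadratic cost `∫ ‖x - y‖² dπ(x, y)` of a transport plan. -/
def transportCost {d : ℕ}
    (π : Measure (EuclideanSpace ℝ (Fin d) × EuclideanSpace ℝ (Fin d))) : ℝ≥0∞ :=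
  ∫⁻ p, ENNReal.ofReal (‖p.1 - p.2‖ ^ 2) ∂π

/-- `π` is a minimizer of the quadratic optimal transport problem between `ρ` and `μ`. -/
def IsOptimalPlan {d : ℕ} (ρ μ : Measure (EuclideanSpace ℝ (Fin d)))
    (π : Measure (EuclideanSpace ℝ (Fin d) × EuclideanSpace ℝ (Fin d))) : Prop :=
  IsTransportPlan ρ μ π ∧ ∀ π', IsTransportPlan ρ μ π' → transportCost π ≤ transportCost π'

/-- `T` is an optimal transport map from `ρ` to `μ`: the plan `(id, T)_# ρ` is optimal.
(In particular `T_# ρ = μ`.) -/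
def IsOptimalMap {d : ℕ} (ρ μ : Measure (EuclideanSpace ℝ (Fin d)))
    (T : EuclideanSpace ℝ (Fin d) → EuclideanSpace ℝ (Fin d)) : Prop :=
  Measurable T ∧ IsOptimalPlan ρ μ (ρ.map fun x => (x, T x))

open Classical in
/-- The optimal transport map `T_ρ^μ` (a representative of it; the identity if there is none). -/
def optimalMap {d : ℕ} (ρ μ : Measure (EuclideanSpace ℝ (Fin d))) :
    EuclideanSpace ℝ (Fin d) → EuclideanSpace ℝ (Fin d) :=
  if h : ∃ T, IsOptimalMap ρ μ T then h.choose else id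

/-- The linearized optimal transport embedding `T_ρ^μ - id` with reference measure `ρ`. -/
def lotEmbedding {d : ℕ} (ρ μ : Measure (EuclideanSpace ℝ (Fin d))) :
    EuclideanSpace ℝ (Fin d) → EuclideanSpace ℝ (Fin d) :=
  fun x => optimalMap ρ μ x - x

/-- The kernel `k(x, y) = xᵀy + (xᵀy)²`. -/
def quadKernel {d : ℕ} (x y : EuclideanSpace ℝ (Fin d)) : ℝ :=
  inner ℝ x y + (inner ℝ x y) ^ 2

/-- The kernel `k` in the form used for reproducing kernel Hilbert spaces in Mathlib: the matrix
indexed by points whose `(x, y)` entry is the operator `v ↦ k(x, y) v` on `ℝ`. -/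
def quadKernelMatrix (d : ℕ) :
    Matrix (EuclideanSpace ℝ (Fin d)) (EuclideanSpace ℝ (Fin d)) (ℝ →L[ℝ] ℝ) :=
  Matrix.of fun x y => quadKernel x y • ContinuousLinearMap.id ℝ ℝ

/-- The feature `k(x, ·)`, as an element of a reproducing kernel Hilbert space `H`
of real functions on `ℝᵈ`. -/
def kernelFeature {d : ℕ} (H : Type*) [NormedAddCommGroup H] [InnerProductSpace ℝ H]
    [CompleteSpace H] [RKHS ℝ H (EuclideanSpace ℝ (Fin d)) ℝ] (x : EuclideanSpace ℝ (Fin d)) : H :=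
  RKHS.kerFun H x (1 : ℝ)

/-- The kernel mean embedding `∫ k(x, ·) dμ(x)`, a Bochner integral in `H`. -/
def kernelMeanEmbedding {d : ℕ} (H : Type*) [NormedAddCommGroup H] [InnerProductSpace ℝ H]
    [CompleteSpace H] [RKHS ℝ H (EuclideanSpace ℝ (Fin d)) ℝ]
    (μ : Measure (EuclideanSpace ℝ (Fin d))) : H :=
  ∫ x, kernelFeature H x ∂μ

end

/-!
The law `ρ` of `R • Z / ‖Z‖` is invariant under linear isometries. Negation gives mean zero, and a
reflection exchanging two unit vectors shows that `∫ ⟪a, x⟫² dρ` depends on `‖a‖` only; summing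
over an orthonormal basis and using `∫₀¹ r² dr = 1/3` gives covariance `1 / (3d)` times the identity
(`isIsotropicOnBall_radial`). Absolute continuity follows from Fubini, since a Lebesgue null set
meets almost every line through the origin in a null set (`radial_absolutelyContinuous`).

For optimal transport, let `A` be positive and let `G` be a generalized inverse, `A G A = A`. For
`y` in the support of the target and `v = G (y - b)`, the cost `‖x - y‖²` is a function of `x` plus
a function of `y` plus `⟪x - v, A (x - v)⟫ ≥ 0`. The first two terms have the same integral for all
plans; the last vanishes exactly where `y = A x + b`. This gives existence and uniqueness of the
optimal map, even for singular `A` (`isOptimalMap_affine`).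

Both inner product formulas then reduce to second moments of affine images of an isotropic measure
(`IsIsotropicOnBall.integral_inner_affine_affine` and its companions). For the kernel, the
reproducing property turns the inner product of two mean embeddings into the double integral of
the kernel; the feature map is continuous, hence integrable on bounded sets.
-/

/-! ### The radial law: absolute continuity and moments -/

theorem absolutelyContinuous_pi_fin {n : ℕ} {μ ν : Fin n → Measure ℝ} [∀ i, SigmaFinite (μ i)]
    [∀ i, SigmaFinite (ν i)] (h : ∀ i, μ i ≪ ν i) : Measure.pi μ ≪ Measure.pi ν := by
  induction n with
  | zero => rw [Measure.pi_of_empty μ, Measure.pi_of_empty ν]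
  | succ n ih =>
    have hμ := (measurePreserving_piFinSuccAbove μ 0).symm
    have hν := (measurePreserving_piFinSuccAbove ν 0).symm
    rw [← hμ.map_eq, ← hν.map_eq]
    exact ((h 0).prod (ih fun i => h _)).map (MeasurableEquiv.measurable _)

theorem stdGaussian_absolutelyContinuous (d : ℕ) :
    stdGaussian (EuclideanSpace ℝ (Fin d)) ≪ volume := by
  rw [← map_pi_eq_stdGaussian, ← (PiLp.volume_preserving_toLp (Fin d)).map_eq]
  exact (absolutelyContinuous_pi_fin fun _ =>
    gaussianReal_absolutelyContinuous 0 one_ne_zero).map (PiLp.volume_preserving_toLp _).measurable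

section SphereLaw

variable {E : Type*} [NormedAddCommGroup E]

theorem norm_inv_norm_smul_le_one [NormedSpace ℝ E] (z : E) : ‖‖z‖⁻¹ • z‖ ≤ 1 := by
  rw [norm_smul, norm_inv, norm_norm]
  exact inv_mul_le_one

variable [InnerProductSpace ℝ E] [FiniteDimensional ℝ E] [MeasurableSpace E] [BorelSpace E]

theorem integrable_of_ae_norm_le_one {F : Type*} [NormedAddCommGroup F] {ρ : Measure E}
    [IsFiniteMeasure ρ] (hρ : ∀ᵐ x ∂ρ, ‖x‖ ≤ 1) {f : E → F} (hf : Continuous f) :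
    Integrable f ρ := by
  obtain ⟨C, hC⟩ := (isCompact_closedBall (0 : E) 1).exists_bound_of_continuousOn hf.continuousOn
  refine Integrable.of_bound hf.aestronglyMeasurable C ?_
  filter_upwards [hρ] with x hx
  exact hC x (by simpa using hx)

variable (E) in
/-- The law of `Z / ‖Z‖` for a standard Gaussian vector `Z`. -/
noncomputable def gaussianDirection : Measure E :=
  (stdGaussian E).map fun z => ‖z‖⁻¹ • z

theorem measurable_inv_norm_smul : Measurable fun z : E => ‖z‖⁻¹ • z := by fun_prop

instance : IsProbabilityMeasure (gaussianDirection E) :=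
  Measure.isProbabilityMeasure_map measurable_inv_norm_smul.aemeasurable

theorem gaussianDirection_norm_le_one : ∀ᵐ u ∂gaussianDirection E, ‖u‖ ≤ 1 :=
  (ae_map_iff measurable_inv_norm_smul.aemeasurable
    (measurableSet_le measurable_norm measurable_const)).2
    (ae_of_all _ norm_inv_norm_smul_le_one)

/-- The standard Gaussian law is invariant under linear isometries, which commute with
normalization. -/
theorem gaussianDirection_map (f : E ≃ₗᵢ[ℝ] E) :
    (gaussianDirection E).map f = gaussianDirection E := by
  conv_rhs => rw [gaussianDirection, ← stdGaussian_map f]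
  rw [gaussianDirection, Measure.map_map f.continuous.measurable measurable_inv_norm_smul,
    Measure.map_map measurable_inv_norm_smul f.continuous.measurable]
  congr 1
  ext z
  simp

theorem integral_gaussianDirection_comp (f : E ≃ₗᵢ[ℝ] E) (g : E → ℝ) :
    ∫ u, g (f u) ∂gaussianDirection E = ∫ u, g u ∂gaussianDirection E := by
  conv_rhs => rw [← gaussianDirection_map f]
  exact (f.toHomeomorph.measurableEmbedding.integral_map g).symm

theorem integral_inner_gaussianDirection (a : E) :
    ∫ u, inner ℝ a u ∂gaussianDirection E = 0 := by
  have h := integral_gaussianDirection_comp (LinearIsometryEquiv.neg ℝ (E := E))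
    (fun u => inner ℝ a u)
  simp only [LinearIsometryEquiv.coe_neg, inner_neg_right, integral_neg] at h
  linarith

/-- A reflection exchanging two vectors of equal norm shows that they have equal second moments. -/
theorem integral_inner_sq_gaussianDirection_congr {a c : E} (h : ‖a‖ = ‖c‖) :
    ∫ u, inner ℝ a u ^ 2 ∂gaussianDirection E = ∫ u, inner ℝ c u ^ 2 ∂gaussianDirection E := by
  -- The reflection in the hyperplane orthogonal to `a - c` swaps `a` and `c`.
  set f := (Submodule.span ℝ {a - c})ᗮ.reflection with hf
  rw [← integral_gaussianDirection_comp f]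
  congr 1
  ext u
  have hac : f a = c := Submodule.reflection_sub h
  have hca : f c = a := by rw [← hac, hf, Submodule.reflection_reflection]
  conv_lhs => rw [← hca, f.inner_map_map]

/-- The second moments in the directions of an orthonormal basis agree and add up to one. -/
theorem integral_inner_sq_gaussianDirection
    (h0 : ∀ᵐ z ∂stdGaussian E, z ≠ 0) (hE : 0 < Module.finrank ℝ E) (a : E) :
    ∫ u, inner ℝ a u ^ 2 ∂gaussianDirection E = ‖a‖ ^ 2 / Module.finrank ℝ E := by
  have hint (c : E) : Integrable (fun u => inner ℝ c u ^ 2) (gaussianDirection E) :=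
    integrable_of_ae_norm_le_one gaussianDirection_norm_le_one (by fun_prop)
  have h1 : ∀ᵐ u ∂gaussianDirection E, ‖u‖ = 1 := by
    refine (ae_map_iff measurable_inv_norm_smul.aemeasurable
      (measurableSet_eq_fun measurable_norm measurable_const)).2 ?_
    filter_upwards [h0] with z hz
    rw [norm_smul, norm_inv, norm_norm, inv_mul_cancel₀ (norm_ne_zero_iff.2 hz)]
  let e := stdOrthonormalBasis ℝ E
  have hsum : ∑ i, ∫ u, inner ℝ (e i) u ^ 2 ∂gaussianDirection E = 1 := by
    rw [← integral_finsetSum _ fun i _ => hint _]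
    simp_rw [e.sum_sq_inner_right]
    rw [integral_congr_ae (g := fun _ => (1 : ℝ))]
    · simp
    · filter_upwards [h1] with u hu
      simp [hu]
  have hi (i) : ∫ u, inner ℝ a u ^ 2 ∂gaussianDirection E
      = ‖a‖ ^ 2 * ∫ u, inner ℝ (e i) u ^ 2 ∂gaussianDirection E := by
    rw [integral_inner_sq_gaussianDirection_congr (a := a) (c := ‖a‖ • e i) (by simp [norm_smul])]
    simp_rw [real_inner_smul_left, mul_pow, integral_const_mul]
  have hd : (Module.finrank ℝ E : ℝ) ≠ 0 := by exact_mod_cast hE.ne'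
  rw [eq_div_iff hd, ← mul_one (‖a‖ ^ 2), ← hsum, Finset.mul_sum, ← Finset.sum_congr rfl
    fun i _ => hi i]
  simp [mul_comm]

/-- The law of `R • Z / ‖Z‖`, with `R` uniform on `[0, 1]` and `Z` standard Gaussian independent
of `R`, as the image of a product measure. -/
theorem map_uniform_smul_gaussianDirection {Ω : Type*} [MeasurableSpace Ω] {P : Measure Ω}
    [IsProbabilityMeasure P] {R : Ω → ℝ} {Z : Ω → E}
    (hR : pdf.IsUniform R (Set.Icc (0 : ℝ) 1) P) (hZ : HasLaw Z (stdGaussian E) P)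
    (hRZ : IndepFun R Z P) :
    P.map (fun ω => R ω • (‖Z ω‖⁻¹ • Z ω)) =
      ((volume.restrict (Set.Icc (0 : ℝ) 1)).prod (gaussianDirection E)).map
        fun p => p.1 • p.2 := by
  have hRm : AEMeasurable R P := hR.aemeasurable (by simp) (by simp)
  have hRl : P.map R = volume.restrict (Set.Icc (0 : ℝ) 1) := by
    rw [hR, ProbabilityTheory.cond]; simp
  have hU : AEMeasurable (fun ω => ‖Z ω‖⁻¹ • Z ω) P :=
    measurable_inv_norm_smul.comp_aemeasurable hZ.aemeasurable
  have hUl : P.map (fun ω => ‖Z ω‖⁻¹ • Z ω) = gaussianDirection E := by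
    rw [gaussianDirection, ← hZ.map_eq, AEMeasurable.map_map_of_aemeasurable
      measurable_inv_norm_smul.aemeasurable hZ.aemeasurable]
    rfl
  have hind : IndepFun R (fun ω => ‖Z ω‖⁻¹ • Z ω) P :=
    hRZ.comp measurable_id measurable_inv_norm_smul
  rw [← hRl, ← hUl, ← hind.map_prod_eq_prod_map_map hRm hU,
    AEMeasurable.map_map_of_aemeasurable (by fun_prop) (hRm.prodMk hU)]
  rfl

instance : IsProbabilityMeasure (volume.restrict (Set.Icc (0 : ℝ) 1)) := ⟨by simp⟩

end SphereLaw

/-- A probability measure concentrated on the closed unit ball, centered, and with covariance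
`σ • 1`. Mean and covariance are tested against vectors. -/
structure IsIsotropicOnBall {E : Type*} [NormedAddCommGroup E] [InnerProductSpace ℝ E]
    [MeasurableSpace E] (ρ : Measure E) (σ : ℝ) : Prop where
  isProbabilityMeasure : IsProbabilityMeasure ρ
  norm_le_one : ∀ᵐ x ∂ρ, ‖x‖ ≤ 1
  integral_inner : ∀ a, ∫ x, inner ℝ a x ∂ρ = 0
  integral_inner_sq : ∀ a, ∫ x, inner ℝ a x ^ 2 ∂ρ = σ * ‖a‖ ^ 2

section Radial

variable {d : ℕ}

local notation "E" => EuclideanSpace ℝ (Fin d)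

theorem stdGaussian_ne_zero (hd : 0 < d) : ∀ᵐ z ∂stdGaussian E, z ≠ 0 := by
  have : Nonempty (Fin d) := ⟨⟨0, hd⟩⟩
  exact (stdGaussian_absolutelyContinuous d).ae_le (Measure.ae_ne volume 0)

theorem isIsotropicOnBall_radial (hd : 0 < d) :
    IsIsotropicOnBall (((volume.restrict (Set.Icc (0 : ℝ) 1)).prod (gaussianDirection E)).map
        fun p => p.1 • p.2) (1 / (3 * (d : ℝ))) := by
  have hm : Measurable fun p : ℝ × E => p.1 • p.2 := by fun_prop
  refine ⟨Measure.isProbabilityMeasure_map hm.aemeasurable, ?_, fun a => ?_, fun a => ?_⟩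
  · rw [ae_map_iff hm.aemeasurable (measurableSet_le measurable_norm measurable_const),
      Measure.ae_prod_iff_ae_ae (measurableSet_le (by fun_prop) measurable_const)]
    filter_upwards [ae_restrict_mem measurableSet_Icc] with r hr
    filter_upwards [gaussianDirection_norm_le_one] with u hu
    rw [norm_smul, Real.norm_of_nonneg hr.1]
    exact mul_le_one₀ hr.2 (norm_nonneg u) hu
  · rw [integral_map hm.aemeasurable (by fun_prop)]
    simp_rw [real_inner_smul_right]
    rw [integral_prod_mul (fun r : ℝ => r) (fun u : E => inner ℝ a u),
      integral_inner_gaussianDirection, mul_zero]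
  · rw [integral_map hm.aemeasurable (by fun_prop)]
    simp_rw [real_inner_smul_right, mul_pow]
    rw [integral_prod_mul (fun r : ℝ => r ^ 2) (fun u : E => inner ℝ a u ^ 2),
      integral_inner_sq_gaussianDirection (stdGaussian_ne_zero hd) (by simpa using hd),
      integral_Icc_eq_integral_Ioc, ← intervalIntegral.integral_of_le zero_le_one, integral_pow]
    have : (d : ℝ) ≠ 0 := by exact_mod_cast hd.ne'
    simp
    field_simp
    ring

/-- If `A` is Lebesgue null, then by Fubini almost every `z` satisfies `t • z ∉ A` for almost
every `t`; this property of `z` depends only on the line through `z`, so it passes to the direction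
`z / ‖z‖` of a Gaussian vector. -/
theorem radial_absolutelyContinuous (hd : 0 < d) :
    (((volume.restrict (Set.Icc (0 : ℝ) 1)).prod (gaussianDirection E)).map
        fun p => p.1 • p.2) ≪ volume := by
  have hm : Measurable fun p : ℝ × E => p.1 • p.2 := by fun_prop
  refine Measure.AbsolutelyContinuous.mk fun A hA hA0 => ?_
  have hae : ∀ᵐ z : E, ∀ᵐ t : ℝ, t • z ∉ A := by
    rw [Measure.ae_ae_comm
      ((hA.preimage (by fun_prop : Measurable fun p : E × ℝ => p.2 • p.1)).compl)]
    filter_upwards [Measure.ae_ne volume (0 : ℝ)] with t ht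
    rw [ae_iff]
    simp only [not_not]
    have := Measure.addHaar_preimage_smul (volume : Measure E) ht A
    rw [hA0, mul_zero] at this
    exact this
  rw [Measure.map_apply hm hA, ← compl_compl ((fun p : ℝ × E => p.1 • p.2) ⁻¹' A),
    ← mem_ae_iff]
  change ∀ᵐ p : ℝ × E ∂_, p.1 • p.2 ∉ A
  have hms : MeasurableSet {p : ℝ × E | p.1 • p.2 ∉ A} := (hA.preimage hm).compl
  rw [Measure.ae_prod_iff_ae_ae hms, Measure.ae_ae_comm hms, gaussianDirection,
    ae_map_iff measurable_inv_norm_smul.aemeasurable]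
  · filter_upwards [(stdGaussian_absolutelyContinuous d).ae_le hae, stdGaussian_ne_zero hd]
      with z hz hz0
    refine ae_restrict_of_ae ?_
    -- Rescaling `t` by `‖z‖⁻¹` preserves Lebesgue null sets of the line.
    have hn : ‖z‖⁻¹ ≠ 0 := inv_ne_zero (norm_ne_zero_iff.2 hz0)
    rw [ae_iff] at hz ⊢
    simp only [not_not] at hz ⊢
    have := Measure.addHaar_preimage_smul (volume : Measure ℝ) hn {t | t • z ∈ A}
    rw [hz, mul_zero] at this
    convert this using 2
    ext t
    simp [smul_smul, mul_comm]
  · have h2 : MeasurableSet {q : E × ℝ | q.2 • q.1 ∉ A} :=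
      (hA.preimage (by fun_prop : Measurable fun p : E × ℝ => p.2 • p.1)).compl
    have := measurable_measure_prodMk_left (ν := volume.restrict (Set.Icc (0 : ℝ) 1)) h2.compl
    exact this (measurableSet_singleton 0)

end Radial

/-! ### Optimality and uniqueness of positive semidefinite affine maps -/

section GeneralizedInverse

variable {E : Type*} [NormedAddCommGroup E]

/-- The equality case: `⟪x + t A x, A (x + t A x)⟫` is a nonnegative quadratic polynomial in `t` with
vanishing constant term, so its linear coefficient `2 ‖A x‖²` vanishes. -/
theorem ContinuousLinearMap.IsPositive.apply_eq_zero_of_inner_eq_zero [InnerProductSpace ℝ E]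
    {A : E →L[ℝ] E} (hA : A.IsPositive) {x : E} (hx : inner ℝ x (A x) = 0) : A x = 0 := by
  have h (t : ℝ) : 0 ≤ inner ℝ (A x) (A (A x)) * (t * t) + 2 * ‖A x‖ ^ 2 * t + 0 := by
    have := hA.inner_nonneg_right (x + t • A x)
    have hs : inner ℝ x (A (A x)) = ‖A x‖ ^ 2 := by
      rw [← hA.inner_left_eq_inner_right, real_inner_self_eq_norm_sq]
    simp only [map_add, map_smul, inner_add_left, inner_add_right, real_inner_smul_left,
      real_inner_smul_right, hx, hs, real_inner_self_eq_norm_sq] at this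
    linarith
  have hd := discrim_le_zero h
  rw [discrim] at hd
  have : ‖A x‖ ^ 2 = 0 := by nlinarith [sq_nonneg (‖A x‖ ^ 2)]
  simpa using this

/-- A right inverse of `A` onto its range, extended linearly to the whole space, is a generalized
inverse. -/
theorem ContinuousLinearMap.exists_generalizedInverse [NormedSpace ℝ E] [FiniteDimensional ℝ E]
    (A : E →L[ℝ] E) : ∃ G : E →L[ℝ] E, ∀ x, A (G (A x)) = A x := by
  obtain ⟨g, hg⟩ := A.toLinearMap.rangeRestrict.exists_rightInverse_of_surjective
    A.toLinearMap.range_rangeRestrict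
  obtain ⟨G, hG⟩ := g.exists_extend
  refine ⟨LinearMap.toContinuousLinearMap G, fun x => ?_⟩
  have h1 := LinearMap.congr_fun hG (A.toLinearMap.rangeRestrict x)
  have h2 := congrArg Subtype.val (LinearMap.congr_fun hg (A.toLinearMap.rangeRestrict x))
  exact (congrArg A h1).trans h2

end GeneralizedInverse

section OptimalTransport

variable {d : ℕ}

local notation "E" => EuclideanSpace ℝ (Fin d)

theorem IsTransportPlan.isProbabilityMeasure {ρ μ : Measure E} [IsProbabilityMeasure ρ]
    {π : Measure (E × E)} (h : IsTransportPlan ρ μ π) : IsProbabilityMeasure π := by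
  refine ⟨?_⟩
  rw [← Set.preimage_univ (f := Prod.fst), ← Measure.map_apply measurable_fst .univ, h.1]
  exact measure_univ

theorem isTransportPlan_graph (ρ : Measure E) {T : E → E} (hT : Measurable T) :
    IsTransportPlan ρ (ρ.map T) (ρ.map fun x => (x, T x)) := by
  constructor
  · rw [Measure.map_map measurable_fst (measurable_id'.prodMk hT)]
    exact Measure.map_id
  · rw [Measure.map_map measurable_snd (measurable_id'.prodMk hT)]
    rfl

/-- If both marginals have compact support, continuous functions are integrable for every plan. -/
theorem IsTransportPlan.integrable {ρ μ : Measure E} [IsProbabilityMeasure ρ] {π : Measure (E × E)}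
    (h : IsTransportPlan ρ μ π) {K L : Set E} (hK : IsCompact K) (hL : IsCompact L)
    (hρ : ∀ᵐ x ∂ρ, x ∈ K) (hμ : ∀ᵐ y ∂μ, y ∈ L) {f : E × E → ℝ} (hf : Continuous f) :
    Integrable f π := by
  have := h.isProbabilityMeasure
  obtain ⟨C, hC⟩ := (hK.prod hL).exists_bound_of_continuousOn hf.continuousOn
  refine Integrable.of_bound hf.aestronglyMeasurable C ?_
  filter_upwards [ae_of_ae_map measurable_fst.aemeasurable (h.1 ▸ hρ),
    ae_of_ae_map measurable_snd.aemeasurable (h.2 ▸ hμ)] with p h1 h2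
  exact hC p ⟨h1, h2⟩

/-- On the range `y = A v + b` of a positive affine map, the quadratic cost splits into a function
of `x`, a function of `y`, and a nonnegative remainder, which vanishes if `v = x`. Here `v` may be
any preimage. -/
theorem norm_sub_sq_eq_of_isPositive {A : E →L[ℝ] E} (hA : A.IsPositive) (b x v y : E)
    (h : A v = y - b) :
    ‖x - y‖ ^ 2 = (‖x‖ ^ 2 - inner ℝ x (A x) - 2 * inner ℝ x b) +
      (‖y‖ ^ 2 - inner ℝ v (A v)) + inner ℝ (x - v) (A (x - v)) := by
  have hs : inner ℝ v (A x) = inner ℝ x (A v) := by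
    rw [← hA.inner_left_eq_inner_right, real_inner_comm]
  rw [norm_sub_sq_real, map_sub]
  simp only [inner_sub_left, inner_sub_right, hs]
  rw [h]
  simp only [inner_sub_right]
  ring

/-- A positive affine map of a measure supported in the unit ball is its unique optimal map: up to
terms that depend on the marginals only, the cost of a plan is the integral of the remainder
`⟨x - v, A (x - v)⟩`, where `A v = y - b`. This is nonnegative, and it vanishes only where
`y = A x + b`. -/
theorem isOptimalMap_affine {ρ : Measure E} [IsProbabilityMeasure ρ] (hρ : ∀ᵐ x ∂ρ, ‖x‖ ≤ 1)
    {A : E →L[ℝ] E} (hA : A.IsPositive) (b : E) :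
    IsOptimalMap ρ (ρ.map fun x => A x + b) (fun x => A x + b) ∧
      ∀ T, IsOptimalMap ρ (ρ.map fun x => A x + b) T → T =ᵐ[ρ] fun x => A x + b := by
  obtain ⟨G, hG⟩ := A.exists_generalizedInverse
  have hTc : Continuous fun x => A x + b := by fun_prop
  set μ := ρ.map fun x => A x + b with hμ
  let F : E → ℝ := fun x => ‖x‖ ^ 2 - inner ℝ x (A x) - 2 * inner ℝ x b
  let H : E → ℝ := fun y => ‖y‖ ^ 2 - inner ℝ (G (y - b)) (A (G (y - b)))
  let D : E × E → ℝ := fun p => inner ℝ (p.1 - G (p.2 - b)) (A (p.1 - G (p.2 - b)))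
  have hF : Continuous F := by fun_prop
  have hH : Continuous H := by fun_prop
  have hD : Continuous D := by fun_prop
  have hD0 (p : E × E) : 0 ≤ D p := hA.inner_nonneg_right _
  have hK : IsCompact (Metric.closedBall (0 : E) 1) := isCompact_closedBall _ _
  have hL := hK.image hTc
  have hρK : ∀ᵐ x ∂ρ, x ∈ Metric.closedBall (0 : E) 1 := by simpa using hρ
  have hμL : ∀ᵐ y ∂μ, y ∈ (fun x => A x + b) '' Metric.closedBall (0 : E) 1 := by
    refine (ae_map_iff hTc.aemeasurable hL.measurableSet).2 ?_
    filter_upwards [hρK] with x hx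
    exact Set.mem_image_of_mem _ hx
  -- The target is concentrated on the range of `A` shifted by `b`, where `G (y - b)` is a preimage.
  have hrange : ∀ᵐ y ∂μ, A (G (y - b)) = y - b := by
    filter_upwards [hμL] with y hy
    obtain ⟨x, -, rfl⟩ := hy
    simp [hG]
  have hsplit (π : Measure (E × E)) (hπ : IsTransportPlan ρ μ π) :
      ∫ p, ‖p.1 - p.2‖ ^ 2 ∂π = (∫ x, F x ∂ρ + ∫ y, H y ∂μ) + ∫ p, D p ∂π := by
    have hF' : ∫ x, F x ∂ρ = ∫ p, F p.1 ∂π := by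
      rw [← hπ.1, integral_map measurable_fst.aemeasurable hF.aestronglyMeasurable]
    have hH' : ∫ y, H y ∂μ = ∫ p, H p.2 ∂π := by
      rw [← hπ.2, integral_map measurable_snd.aemeasurable hH.aestronglyMeasurable]
    have hFi : Integrable (fun p : E × E => F p.1) π :=
      hπ.integrable hK hL hρK hμL (by fun_prop)
    have hHi : Integrable (fun p : E × E => H p.2) π :=
      hπ.integrable hK hL hρK hμL (by fun_prop)
    have hDi : Integrable D π := hπ.integrable hK hL hρK hμL hD
    have hFHi : Integrable (fun p : E × E => F p.1 + H p.2) π := hFi.add hHi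
    rw [hF', hH', ← integral_add hFi hHi, ← integral_add hFHi hDi]
    refine integral_congr_ae ?_
    filter_upwards [ae_of_ae_map measurable_snd.aemeasurable (hπ.2 ▸ hrange)] with p hp
    exact norm_sub_sq_eq_of_isPositive hA b p.1 _ p.2 hp
  have hcost (π : Measure (E × E)) (hπ : IsTransportPlan ρ μ π) :
      transportCost π = ENNReal.ofReal (∫ p, ‖p.1 - p.2‖ ^ 2 ∂π) :=
    (ofReal_integral_eq_lintegral_ofReal (hπ.integrable hK hL hρK hμL (by fun_prop))
      (ae_of_all _ fun p => sq_nonneg _)).symm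
  have hplan : IsTransportPlan ρ μ (ρ.map fun x => (x, A x + b)) :=
    isTransportPlan_graph ρ hTc.measurable
  have hDT : ∫ p, D p ∂(ρ.map fun x => (x, A x + b)) = 0 := by
    rw [integral_map (by fun_prop) hD.aestronglyMeasurable]
    have (x : E) : D (x, A x + b) = 0 := by simp [D, hG]
    simp [this]
  refine ⟨⟨hTc.measurable, hplan, fun π' hπ' => ?_⟩, fun T hT => ?_⟩
  · rw [hcost _ hplan, hcost _ hπ', hsplit _ hplan, hsplit _ hπ', hDT]
    exact ENNReal.ofReal_le_ofReal (by gcongr; exact integral_nonneg hD0)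
  · obtain ⟨hTm, hTp, hTopt⟩ := hT
    have hle := hTopt _ hplan
    -- Optimality forces the integral of the nonnegative remainder to vanish.
    rw [hcost _ hplan, hcost _ hTp, ENNReal.ofReal_le_ofReal_iff
      (integral_nonneg fun p => sq_nonneg _), hsplit _ hplan, hsplit _ hTp, hDT] at hle
    have hzero : ∫ p, D p ∂(ρ.map fun x => (x, T x)) = 0 :=
      le_antisymm (by linarith) (integral_nonneg hD0)
    rw [integral_eq_zero_iff_of_nonneg hD0 (hTp.integrable hK hL hρK hμL hD)] at hzero
    have hm : AEMeasurable (fun x => (x, T x)) ρ := (measurable_id.prodMk hTm).aemeasurable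
    filter_upwards [ae_of_ae_map hm hzero, ae_of_ae_map hm
      (ae_of_ae_map measurable_snd.aemeasurable (hTp.2 ▸ hrange))] with x h1 h2
    have h3 := hA.apply_eq_zero_of_inner_eq_zero h1
    rw [map_sub, sub_eq_zero] at h3
    simp only at h2 h3
    rw [h3, h2, sub_add_cancel]

end OptimalTransport

/-! ### Second moments of affine images of an isotropic measure -/

namespace IsIsotropicOnBall

variable {E : Type*} [NormedAddCommGroup E] [InnerProductSpace ℝ E] [FiniteDimensional ℝ E]
  [MeasurableSpace E] [BorelSpace E] {ρ : Measure E} {σ : ℝ} (hρ : IsIsotropicOnBall ρ σ)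

include hρ

theorem integrable {F : Type*} [NormedAddCommGroup F] {f : E → F} (hf : Continuous f) :
    Integrable f ρ :=
  have := hρ.isProbabilityMeasure
  integrable_of_ae_norm_le_one hρ.norm_le_one hf

/-- Polarization of the second moments. -/
theorem integral_inner_mul_inner (a c : E) :
    ∫ x, inner ℝ a x * inner ℝ c x ∂ρ = σ * inner ℝ a c := by
  have h (x : E) : inner ℝ a x * inner ℝ c x =
      (1 / 4) * (inner ℝ (a + c) x ^ 2 - inner ℝ (a - c) x ^ 2) := by
    simp only [inner_add_left, inner_sub_left]
    ring
  simp_rw [h]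
  rw [integral_const_mul, integral_sub (hρ.integrable (by fun_prop)) (hρ.integrable (by fun_prop)),
    hρ.integral_inner_sq, hρ.integral_inner_sq, norm_add_sq_real, norm_sub_sq_real]
  ring

/-- The sum is the Hilbert-Schmidt inner product of `A` and `B`. -/
theorem integral_inner_map_map {ι F : Type*} [Fintype ι] [NormedAddCommGroup F]
    [InnerProductSpace ℝ F] (e : OrthonormalBasis ι ℝ E) (A B : E →L[ℝ] F) :
    ∫ x, inner ℝ (A x) (B x) ∂ρ = σ * ∑ i, inner ℝ (A (e i)) (B (e i)) := by
  classical
  have h (x : E) : inner ℝ (A x) (B x) = ∑ i, ∑ j,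
      (inner ℝ (e i) x * inner ℝ (e j) x) * inner ℝ (A (e i)) (B (e j)) := by
    conv_lhs => rw [← e.sum_repr' x]
    simp only [map_sum, map_smul, sum_inner, inner_sum, real_inner_smul_left,
      real_inner_smul_right]
    rw [Finset.sum_comm]
    exact Finset.sum_congr rfl fun i _ => Finset.sum_congr rfl fun j _ => by ring
  simp_rw [h]
  rw [integral_finsetSum _ fun i _ => hρ.integrable (by fun_prop), Finset.mul_sum]
  refine Finset.sum_congr rfl fun i _ => ?_
  rw [integral_finsetSum _ fun i _ => hρ.integrable (by fun_prop)]
  simp_rw [integral_mul_const, hρ.integral_inner_mul_inner,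
    orthonormal_iff_ite.1 e.orthonormal]
  simp

theorem integral_inner_affine (A : E →L[ℝ] E) (a b : E) :
    ∫ x, inner ℝ a (A x + b) ∂ρ = inner ℝ a b := by
  have := hρ.isProbabilityMeasure
  simp_rw [inner_add_right, ← ContinuousLinearMap.adjoint_inner_left]
  rw [integral_add (hρ.integrable (by fun_prop)) (integrable_const _), hρ.integral_inner]
  simp

theorem integral_inner_affine_sq (A : E →L[ℝ] E) (a b : E) :
    ∫ x, inner ℝ a (A x + b) ^ 2 ∂ρ = inner ℝ a b ^ 2 + σ * ‖A.adjoint a‖ ^ 2 := by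
  have := hρ.isProbabilityMeasure
  simp_rw [inner_add_right, ← ContinuousLinearMap.adjoint_inner_left, add_sq]
  rw [integral_add (hρ.integrable (by fun_prop)) (integrable_const _),
    integral_add (hρ.integrable (by fun_prop)) (hρ.integrable (by fun_prop)), integral_mul_const,
    integral_const_mul, hρ.integral_inner, hρ.integral_inner_sq]
  simp
  ring

theorem integral_inner_affine_affine {ι : Type*} [Fintype ι] (e : OrthonormalBasis ι ℝ E)
    (A B : E →L[ℝ] E) (b c : E) :
    ∫ x, inner ℝ (A x + b) (B x + c) ∂ρ =
      inner ℝ b c + σ * ∑ i, inner ℝ (A (e i)) (B (e i)) := by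
  have := hρ.isProbabilityMeasure
  have h (x : E) : inner ℝ (A x + b) (B x + c) =
      inner ℝ (A x) (B x) + inner ℝ (A.adjoint c) x + inner ℝ (B.adjoint b) x + inner ℝ b c := by
    simp only [inner_add_left, inner_add_right, ContinuousLinearMap.adjoint_inner_left,
      real_inner_comm (A x) c]
    ring
  simp_rw [h]
  rw [integral_add (hρ.integrable (by fun_prop)) (integrable_const _),
    integral_add (hρ.integrable (by fun_prop)) (hρ.integrable (by fun_prop)),
    integral_add (hρ.integrable (by fun_prop)) (hρ.integrable (by fun_prop)),
    hρ.integral_inner, hρ.integral_inner, hρ.integral_inner_map_map e]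
  simp
  ring

end IsIsotropicOnBall

/-! ### The quadratic kernel and its mean embeddings -/

section Kernel

variable {d : ℕ}

local notation "E" => EuclideanSpace ℝ (Fin d)

/-- The quadratic form of the kernel is `‖∑ w x‖² + ‖∑ w x ⊗ x‖²`. -/
theorem posSemidef_quadKernelMatrix (d : ℕ) : (quadKernelMatrix d).PosSemidef := by
  have htfae := (RKHS.posSemidef_tfae (K := quadKernelMatrix d)).out 0 2
  refine htfae.2 ⟨?_, fun w => ?_⟩
  · ext x y
    simp [quadKernelMatrix, quadKernel, Matrix.conjTranspose_apply, real_inner_comm x y,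
      ContinuousLinearMap.star_eq_adjoint, ContinuousLinearMap.adjoint_id]
  · have h : (w.sum fun x s => w.sum fun y t => inner ℝ (quadKernelMatrix d y x s) t) =
        ‖∑ x ∈ w.support, w x • x‖ ^ 2 +
          ∑ k : Fin d × Fin d, (∑ x ∈ w.support, w x * (x k.1 * x k.2)) ^ 2 := by
      have h2 : ∑ k : Fin d × Fin d, (∑ x ∈ w.support, w x * (x k.1 * x k.2)) ^ 2 =
          ∑ x ∈ w.support, ∑ y ∈ w.support, w x * w y * inner ℝ x y ^ 2 := by
        simp_rw [sq (Finset.sum _ _), Finset.sum_mul_sum]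
        rw [Finset.sum_comm]
        refine Finset.sum_congr rfl fun x _ => ?_
        rw [Finset.sum_comm]
        refine Finset.sum_congr rfl fun y _ => ?_
        rw [Fintype.sum_prod_type, sq, PiLp.inner_apply, Finset.sum_mul_sum, Finset.mul_sum]
        refine Finset.sum_congr rfl fun k _ => ?_
        rw [Finset.mul_sum]
        refine Finset.sum_congr rfl fun l _ => ?_
        simp
        ring
      rw [h2, ← real_inner_self_eq_norm_sq]
      simp only [sum_inner, inner_sum, real_inner_smul_left, real_inner_smul_right, Finsupp.sum,
        ← Finset.sum_add_distrib]
      refine Finset.sum_congr rfl fun x _ => Finset.sum_congr rfl fun y _ => ?_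
      simp [quadKernelMatrix, quadKernel, real_inner_comm x y]
      ring
    rw [h]
    exact add_nonneg (sq_nonneg _) (Finset.sum_nonneg fun _ _ => sq_nonneg _)

variable {H : Type*} [NormedAddCommGroup H] [InnerProductSpace ℝ H] [CompleteSpace H]
  [RKHS ℝ H (EuclideanSpace ℝ (Fin d)) ℝ]

theorem inner_kernelFeature (hH : RKHS.kernel H = quadKernelMatrix d)
    (x y : E) :
    inner ℝ (kernelFeature H x) (kernelFeature H y) = quadKernel x y := by
  rw [kernelFeature, kernelFeature, ← RKHS.kernel_inner, hH]
  simp [quadKernelMatrix, quadKernel, real_inner_comm x y]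

/-- The distance of two features is a continuous expression in the kernel. -/
theorem continuous_kernelFeature (hH : RKHS.kernel H = quadKernelMatrix d)
    : Continuous fun x : E => kernelFeature H x := by
  have h (x y : E) : dist (kernelFeature H x) (kernelFeature H y) =
      √(quadKernel x x - 2 * quadKernel x y + quadKernel y y) := by
    rw [dist_eq_norm, ← Real.sqrt_sq (norm_nonneg _), norm_sub_sq_real,
      ← real_inner_self_eq_norm_sq, ← real_inner_self_eq_norm_sq, inner_kernelFeature hH,
      inner_kernelFeature hH, inner_kernelFeature hH]
  refine continuous_iff_continuousAt.2 fun y => tendsto_iff_dist_tendsto_zero.2 ?_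
  simp_rw [h]
  have hc : Continuous fun x : E => √(quadKernel x x - 2 * quadKernel x y + quadKernel y y) := by
    unfold quadKernel
    fun_prop
  convert hc.tendsto y using 2
  ring_nf
  simp

theorem inner_kernelMeanEmbedding (hH : RKHS.kernel H = quadKernelMatrix d)
    {μ ν : Measure E}
    (hμ : Integrable (fun x => kernelFeature H x) μ)
    (hν : Integrable (fun x => kernelFeature H x) ν) :
    inner ℝ (kernelMeanEmbedding H μ) (kernelMeanEmbedding H ν) =
      ∫ x, ∫ y, quadKernel x y ∂ν ∂μ := by
  rw [kernelMeanEmbedding, real_inner_comm, ← integral_inner hμ]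
  refine integral_congr_ae (ae_of_all _ fun x => ?_)
  simp only
  rw [real_inner_comm, kernelMeanEmbedding, ← integral_inner hν]
  simp_rw [inner_kernelFeature hH]

end Kernel

/-! ### Matrix square roots and the Frobenius inner product -/

section Matrices

variable {d : ℕ}

theorem shiftScale_eq (S : Matrix (Fin d) (Fin d) ℝ) (b x : EuclideanSpace ℝ (Fin d)) :
    shiftScale S b x = Matrix.toEuclideanCLM (𝕜 := ℝ) (CFC.sqrt S) x + b := rfl

theorem isPositive_toEuclideanCLM_sqrt (S : Matrix (Fin d) (Fin d) ℝ) :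
    (Matrix.toEuclideanCLM (𝕜 := ℝ) (CFC.sqrt S)).IsPositive := by
  rw [← ContinuousLinearMap.isPositive_toLinearMap_iff]
  exact Matrix.isPositive_toEuclideanLin_iff.2 (Matrix.nonneg_iff_posSemidef.1 (CFC.sqrt_nonneg S))

theorem sum_inner_toEuclideanCLM (M N : Matrix (Fin d) (Fin d) ℝ) :
    ∑ i, inner ℝ (Matrix.toEuclideanCLM (𝕜 := ℝ) M (EuclideanSpace.basisFun (Fin d) ℝ i))
      (Matrix.toEuclideanCLM (𝕜 := ℝ) N (EuclideanSpace.basisFun (Fin d) ℝ i)) =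
      frobInner M N := by
  simp only [frobInner, Matrix.trace, Matrix.diag, Matrix.mul_apply, PiLp.inner_apply,
    Matrix.ofLp_toEuclideanCLM]
  simp [mul_comm]

theorem norm_sq_toEuclideanCLM_sqrt {S : Matrix (Fin d) (Fin d) ℝ} (hS : S.PosSemidef)
    (b : EuclideanSpace ℝ (Fin d)) :
    ‖Matrix.toEuclideanCLM (𝕜 := ℝ) (CFC.sqrt S) b‖ ^ 2 =
      frobInner S (Matrix.vecMulVec b b) := by
  have hsq : CFC.sqrt S * CFC.sqrt S = S :=
    CFC.sqrt_mul_sqrt_self S (Matrix.nonneg_iff_posSemidef.2 hS)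
  rw [← real_inner_self_eq_norm_sq,
    (isPositive_toEuclideanCLM_sqrt S).inner_left_eq_inner_right,
    ← mul_apply_eq_comp, ← map_mul, hsq, frobInner, Matrix.mul_vecMulVec,
    Matrix.trace_vecMulVec, ← Matrix.conjTranspose_eq_transpose_of_trivial, hS.isHermitian.eq]
  simp [PiLp.inner_apply, dotProduct]

theorem frobInner_sqrt_mul_sqrt {S T : Matrix (Fin d) (Fin d) ℝ} (hS : S.PosSemidef)
    (hT : T.PosSemidef) :
    frobInner (CFC.sqrt T * CFC.sqrt S) (CFC.sqrt T * CFC.sqrt S) = frobInner S T := by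
  have hsq {S : Matrix (Fin d) (Fin d) ℝ} (hS : S.PosSemidef) : CFC.sqrt S * CFC.sqrt S = S :=
    CFC.sqrt_mul_sqrt_self S (Matrix.nonneg_iff_posSemidef.2 hS)
  have ht (S : Matrix (Fin d) (Fin d) ℝ) : (CFC.sqrt S)ᵀ = CFC.sqrt S := by
    rw [← Matrix.conjTranspose_eq_transpose_of_trivial,
      (Matrix.nonneg_iff_posSemidef.1 (CFC.sqrt_nonneg S)).isHermitian.eq]
  rw [frobInner, frobInner, Matrix.transpose_mul, ht, ht, Matrix.mul_assoc,
    ← Matrix.mul_assoc (CFC.sqrt T), hsq hT, Matrix.trace_mul_comm, Matrix.mul_assoc, hsq hS,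
    Matrix.trace_mul_comm, ← Matrix.conjTranspose_eq_transpose_of_trivial, hS.isHermitian.eq]

/-- The double integral that gives the inner products of the kernel mean embeddings. -/
theorem IsIsotropicOnBall.integral_integral_quadKernel {ρ : Measure (EuclideanSpace ℝ (Fin d))}
    {σ : ℝ} (hρ : IsIsotropicOnBall ρ σ) {S T : Matrix (Fin d) (Fin d) ℝ} (hS : S.PosSemidef)
    (hT : T.PosSemidef) (b c : EuclideanSpace ℝ (Fin d)) :
    ∫ x, ∫ y, quadKernel (shiftScale S b x) (shiftScale T c y) ∂ρ ∂ρ =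
      inner ℝ b c + inner ℝ b c ^ 2 + σ * frobInner T (Matrix.vecMulVec b b) +
        σ * frobInner S (Matrix.vecMulVec c c) + σ ^ 2 * frobInner S T := by
  simp_rw [shiftScale_eq]
  have hA := isPositive_toEuclideanCLM_sqrt S
  have hB := isPositive_toEuclideanCLM_sqrt T
  have hBA : Matrix.toEuclideanCLM (𝕜 := ℝ) (CFC.sqrt T) * Matrix.toEuclideanCLM (𝕜 := ℝ)
      (CFC.sqrt S) = Matrix.toEuclideanCLM (𝕜 := ℝ) (CFC.sqrt T * CFC.sqrt S) :=
    (map_mul _ _ _).symm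
  rw [← norm_sq_toEuclideanCLM_sqrt hS, ← norm_sq_toEuclideanCLM_sqrt hT,
    ← frobInner_sqrt_mul_sqrt hS hT, ← sum_inner_toEuclideanCLM, ← hBA]
  set A := Matrix.toEuclideanCLM (𝕜 := ℝ) (CFC.sqrt S)
  set B := Matrix.toEuclideanCLM (𝕜 := ℝ) (CFC.sqrt T)
  set e := EuclideanSpace.basisFun (Fin d) ℝ
  have hin (x : EuclideanSpace ℝ (Fin d)) : ∫ y, quadKernel (A x + b) (B y + c) ∂ρ =
      inner ℝ c (A x + b) + inner ℝ c (A x + b) ^ 2 +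
        σ * inner ℝ ((B * A) x + B b) ((B * A) x + B b) := by
    simp only [quadKernel]
    rw [integral_add (hρ.integrable (by fun_prop)) (hρ.integrable (by fun_prop)),
      hρ.integral_inner_affine, hρ.integral_inner_affine_sq, hB.isSelfAdjoint.adjoint_eq,
      real_inner_self_eq_norm_sq, real_inner_comm, map_add, mul_apply_eq_comp]
    ring
  simp_rw [hin]
  rw [integral_add (hρ.integrable (by fun_prop)) (hρ.integrable (by fun_prop)),
    integral_add (hρ.integrable (by fun_prop)) (hρ.integrable (by fun_prop)),
    hρ.integral_inner_affine, hρ.integral_inner_affine_sq, hA.isSelfAdjoint.adjoint_eq,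
    integral_const_mul, hρ.integral_inner_affine_affine e, real_inner_comm c b,
    real_inner_self_eq_norm_sq]
  ring

end Matrices

/-! ### Inner products of the two embeddings -/

theorem mainTheorem12 {d N : ℕ} (hd : 0 < d)
    {Ω : Type*} [MeasurableSpace Ω] (P : Measure Ω) [IsProbabilityMeasure P]
    (R : Ω → ℝ) (Z : Ω → EuclideanSpace ℝ (Fin d))
    (hR : pdf.IsUniform R (Set.Icc (0 : ℝ) 1) P)
    (hZ : HasLaw Z (stdGaussian (EuclideanSpace ℝ (Fin d))) P)
    (hRZ : IndepFun R Z P)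
    (ρ : Measure (EuclideanSpace ℝ (Fin d)))
    (hρ : ρ = P.map (fun ω => R ω • (‖Z ω‖⁻¹ • Z ω)))
    (S : Fin N → Matrix (Fin d) (Fin d) ℝ) (hS : ∀ i, (S i).PosSemidef)
    (b : Fin N → EuclideanSpace ℝ (Fin d))
    (μ : Fin N → Measure (EuclideanSpace ℝ (Fin d)))
    (hμ : ∀ i, μ i = ρ.map (shiftScale (S i) (b i))) :
    -- `ρ` is an absolutely continuous probability measure with compact support
    (IsProbabilityMeasure ρ ∧ ρ ≪ volume ∧ IsCompact ρ.support) ∧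
    -- (i) the optimal maps from `ρ` exist and are unique `ρ`-a.e., the LOT embeddings lie in
    -- `L²(ρ)`, and their inner products there are as follows
    ((∀ i, IsOptimalMap ρ (μ i) (optimalMap ρ (μ i)) ∧
        ∀ T, IsOptimalMap ρ (μ i) T → T =ᵐ[ρ] optimalMap ρ (μ i)) ∧
      ∃ hφ : ∀ i, MemLp (lotEmbedding ρ (μ i)) 2 ρ, ∀ i j,
        inner ℝ ((hφ i).toLp (lotEmbedding ρ (μ i))) ((hφ j).toLp (lotEmbedding ρ (μ j))) =
          inner ℝ (b i) (b j) +
            1 / (3 * (d : ℝ)) * frobInner (CFC.sqrt (S i) - 1) (CFC.sqrt (S j) - 1)) ∧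
    -- (ii) the kernel is positive semidefinite, and in its reproducing kernel Hilbert space the
    -- kernel mean embeddings are well defined and have the following inner products
    ((quadKernelMatrix d).PosSemidef ∧
      ∀ (H : Type*) [NormedAddCommGroup H] [InnerProductSpace ℝ H] [CompleteSpace H]
        [RKHS ℝ H (EuclideanSpace ℝ (Fin d)) ℝ], RKHS.kernel H = quadKernelMatrix d →
        (∀ i, Integrable (fun x => kernelFeature H x) (μ i)) ∧
        ∀ i j, inner ℝ (kernelMeanEmbedding H (μ i)) (kernelMeanEmbedding H (μ j)) =
          inner ℝ (b i) (b j) + (inner ℝ (b i) (b j)) ^ 2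
            + 1 / (3 * (d : ℝ)) * frobInner (S j) (Matrix.vecMulVec (b i) (b i))
            + 1 / (3 * (d : ℝ)) * frobInner (S i) (Matrix.vecMulVec (b j) (b j))
            + 1 / (9 * (d : ℝ) ^ 2) * frobInner (S i) (S j)) := by
  rw [map_uniform_smul_gaussianDirection hR hZ hRZ] at hρ
  have hiso : IsIsotropicOnBall ρ (1 / (3 * (d : ℝ))) := hρ ▸ isIsotropicOnBall_radial hd
  have hprob := hiso.isProbabilityMeasure
  set A : Fin N → EuclideanSpace ℝ (Fin d) →L[ℝ] EuclideanSpace ℝ (Fin d) :=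
    fun i => Matrix.toEuclideanCLM (𝕜 := ℝ) (CFC.sqrt (S i))
  have hcont (i) : Continuous (shiftScale (S i) (b i)) :=
    ((A i).continuous.add continuous_const :)
  have hopt (i) : IsOptimalMap ρ (μ i) (shiftScale (S i) (b i)) ∧
      ∀ T, IsOptimalMap ρ (μ i) T → T =ᵐ[ρ] shiftScale (S i) (b i) := by
    rw [hμ i]
    exact isOptimalMap_affine hiso.norm_le_one (isPositive_toEuclideanCLM_sqrt (S i)) (b i)
  have hspec (i) : IsOptimalMap ρ (μ i) (optimalMap ρ (μ i)) := by
    have hex : ∃ T, IsOptimalMap ρ (μ i) T := ⟨_, (hopt i).1⟩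
    rw [optimalMap, dif_pos hex]
    exact hex.choose_spec
  have hae (i) : optimalMap ρ (μ i) =ᵐ[ρ] shiftScale (S i) (b i) := (hopt i).2 _ (hspec i)
  have hlot (i) : lotEmbedding ρ (μ i) =ᵐ[ρ]
      fun x => Matrix.toEuclideanCLM (𝕜 := ℝ) (CFC.sqrt (S i) - 1) x + b i := by
    filter_upwards [hae i] with x hx
    rw [lotEmbedding, hx, shiftScale_eq, map_sub, map_one, sub_apply,
      one_apply_eq_self]
    abel
  have hmem (i) : MemLp (lotEmbedding ρ (μ i)) 2 ρ := by
    refine (memLp_congr_ae (hlot i)).2 ((memLp_two_iff_integrable_sq_norm ?_).2 ?_)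
    · exact Continuous.aestronglyMeasurable (by fun_prop)
    · exact hiso.integrable (by fun_prop)
  refine ⟨⟨hprob, hρ ▸ radial_absolutelyContinuous hd, ?_⟩,
    ⟨fun i => ⟨hspec i, fun T hT => ((hopt i).2 T hT).trans (hae i).symm⟩, hmem, fun i j => ?_⟩,
    posSemidef_quadKernelMatrix d, ?_⟩
  · refine (isCompact_closedBall (0 : EuclideanSpace ℝ (Fin d)) 1).of_isClosed_subset
      Measure.isClosed_support (Measure.support_subset_of_isClosed Metric.isClosed_closedBall ?_)
    filter_upwards [hiso.norm_le_one] with x hx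
    simpa using hx
  · rw [L2.inner_def, ← sum_inner_toEuclideanCLM,
      ← hiso.integral_inner_affine_affine (EuclideanSpace.basisFun (Fin d) ℝ)]
    refine integral_congr_ae ?_
    filter_upwards [(hmem i).coeFn_toLp, (hmem j).coeFn_toLp, hlot i, hlot j] with x h1 h2 h3 h4
    rw [h1, h2, h3, h4]
  · intro H _ _ _ _ hH
    have hφ := continuous_kernelFeature hH
    have hint (i) : Integrable (fun x => kernelFeature H x) (μ i) := by
      rw [hμ i, integrable_map_measure hφ.aestronglyMeasurable (hcont i).aemeasurable]
      exact hiso.integrable (hφ.comp (hcont i))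
    refine ⟨hint, fun i j => ?_⟩
    have hk (x : EuclideanSpace ℝ (Fin d)) : Continuous fun y => quadKernel x y := by
      unfold quadKernel
      fun_prop
    rw [inner_kernelMeanEmbedding hH (hint i) (hint j), hμ i, hμ j]
    have hinner (x : EuclideanSpace ℝ (Fin d)) :
        ∫ y, quadKernel x y ∂(ρ.map (shiftScale (S j) (b j))) =
          ∫ y, quadKernel x (shiftScale (S j) (b j) y) ∂ρ :=
      integral_map (hcont j).aemeasurable (hk x).aestronglyMeasurable
    simp_rw [hinner]
    rw [integral_map (hcont i).aemeasurable ?_]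
    · rw [hiso.integral_integral_quadKernel (hS i) (hS j)]
      have : (d : ℝ) ≠ 0 := by exact_mod_cast hd.ne'
      field_simp
      ring
    · have h2 : Continuous fun p : EuclideanSpace ℝ (Fin d) × EuclideanSpace ℝ (Fin d) =>
          quadKernel p.1 (shiftScale (S j) (b j) p.2) := by
        unfold quadKernel
        exact Continuous.add (by fun_prop) (by fun_prop)
      exact h2.stronglyMeasurable.integral_prod_right.aestronglyMeasurable
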